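/- Let $d\ge 1$ and let $x_1,x_2,\dots$ be independent random points, uniformly distributed on $[0,1]^d$. For each $n$ let $q=q_n\ge 1$ be an integer, with $q=O(n^{1/d})$ as $n\to\infty$, and let $\mathcal S_q=\{s_1,\dots,s_q\}\subset[0,1]^d$ be (deterministic) design points. Write $D^*(\mathcal S_q)=\sup_{a\in[0,1]^d}\bigl|\frac1q\sum_{i=1}^q 1\{s_i\in\prod_{k=1}^d[0,a_k)\}-\prod_{k=1}^d a_k\bigr|$ for their star discrepancy, and suppose that $D^*(\mathcal S_q)=O(q^{-(1-\delta)})$ as $n\to\infty$, for a given $\delta>0$. For $j=1,\dots,q$ let $x_j^*$ be a nearest neighbour (in Euclidean distance, ties broken arbitrarily) of $s_j$ among $x_1,\dots,x_n$. Let $(\phi_\nu)_{\nu\in I}$ be any family of measurable real functions on $[0,1]^d$ (for instance the eigenfunctions of a smoothing-spline penalty) such that, for some constant $C_2$, the total variation of $\phi_\nu\phi_\mu$ on $[0,1]^d$ in the sense of Hardy and Krause (anchored at $(1,\dots,1)$) is at most $C_2$ for all $\nu,\mu\in I$. Then all products $\phi_\nu\phi_\mu$ are integrable on $[0,1]^d$,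 and $$\left|\int_{[0,1]^d}\phi_\nu\phi_\mu\,dx-\frac1q\sum_{j=1}^q\phi_\nu(x_j^*)\phi_\mu(x_j^*)\right|=O_p\bigl(q^{-(1-\delta)}\bigr)\qquad(n\to\infty)$$ uniformly over all $\nu,\mu\in I$; that is, for every $\varepsilon>0$ there is $M$ such that for all large $n$, with probability at least $1-\varepsilon$, the left-hand side is at most $M q^{-(1-\delta)}$ for all $\nu,\mu\in I$ simultaneously. -/

import Mathlib

open MeasureTheory ProbabilityTheory Filter Asymptotics
open scoped ENNReal NNReal

noncomputable section

/-- The unit cube `[0,1]^d` in Euclidean space. -/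
def unitCube (d : ℕ) : Set (EuclideanSpace ℝ (Fin d)) :=
  {x | ∀ j, x j ∈ Set.Icc (0 : ℝ) 1}

/-- The half-open hyper-rectangle `[0,a) = ∏ⱼ [0,aⱼ)`. -/
def anchoredBox {d : ℕ} (a : EuclideanSpace ℝ (Fin d)) : Set (EuclideanSpace ℝ (Fin d)) :=
  {x | ∀ j, x j ∈ Set.Ico (0 : ℝ) (a j)}

/-- The local discrepancy `|(1/q) ∑ᵢ 1{tᵢ ∈ [0,a)} - ∏ⱼ aⱼ|`. -/
def localDiscrepancy {d q : ℕ} (t : Fin q → EuclideanSpace ℝ (Fin d))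
    (a : EuclideanSpace ℝ (Fin d)) : ℝ :=
  |(1 / (q : ℝ)) * ∑ i, (anchoredBox a).indicator (fun _ => (1 : ℝ)) (t i) - ∏ j, a j|

/-- The star discrepancy: the supremum of the local discrepancies over `a ∈ [0,1]^d`. -/
def starDiscrepancy {d q : ℕ} (t : Fin q → EuclideanSpace ℝ (Fin d)) : ℝ :=
  ⨆ a : unitCube d, localDiscrepancy t (a : EuclideanSpace ℝ (Fin d))

/-- The point whose coordinates are `a j` for `j ∈ v`, `b j` for `j ∈ u \ v`, and `1` for `j ∉ u`
(used with `v ⊆ u`): a vertex of the box `∏_{j ∈ u} [a j, b j]` on the face of the cube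
on which all coordinates outside `u` are equal to `1`. -/
def faceVertex {d : ℕ} (u v : Finset (Fin d)) (a b : Fin d → ℝ) : EuclideanSpace ℝ (Fin d) :=
  WithLp.toLp 2 (fun j => if j ∈ v then a j else if j ∈ u then b j else 1)

/-- The alternating sum `Δ_u(f; a, b) = ∑_{v ⊆ u} (-1)^|v| f(a_v, b_{u \ v}, 1)`. -/
def alternatingSum {d : ℕ} (f : EuclideanSpace ℝ (Fin d) → ℝ) (u : Finset (Fin d))
    (a b : Fin d → ℝ) : ℝ :=
  ∑ v ∈ u.powerset, (-1 : ℝ) ^ v.card * f (faceVertex u v a b)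

/-- `y` gives, for every coordinate `j`, a partition `0 = y j 0 ≤ ⋯ ≤ y j m = 1` of `[0,1]`.
(Points may be repeated, so that one `m` serves for all coordinates.) -/
def IsGrid {d : ℕ} (m : ℕ) (y : Fin d → ℕ → ℝ) : Prop :=
  ∀ j, Monotone (y j) ∧ y j 0 = 0 ∧ y j m = 1

/-- The indices of the cells of an `m`-step grid in the coordinates of `u`
(the coordinates outside `u` carry the dummy index `0`). -/
def gridCells {d : ℕ} (m : ℕ) (u : Finset (Fin d)) : Finset (Fin d → ℕ) :=
  Fintype.piFinset (fun j => if j ∈ u then Finset.range m else {0})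

/-- The variation in the sense of Vitali of the restriction of `f` to the face of `[0,1]^d`
on which all coordinates outside `u` are equal to `1`. -/
def vitaliVariation {d : ℕ} (f : EuclideanSpace ℝ (Fin d) → ℝ) (u : Finset (Fin d)) : ℝ≥0∞ :=
  ⨆ (m : ℕ) (y : Fin d → ℕ → ℝ) (_ : IsGrid m y),
    ∑ k ∈ gridCells m u,
      ENNReal.ofReal |alternatingSum f u (fun j => y j (k j)) (fun j => y j (k j + 1))|

/-- The total variation on `[0,1]^d` in the sense of Hardy and Krause: the sum, over all nonempty
sets `u` of coordinates, of the Vitali variations on the faces through `(1,…,1)`. -/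
def hardyKrauseVariation {d : ℕ} (f : EuclideanSpace ℝ (Fin d) → ℝ) : ℝ≥0∞ :=
  ∑ u ∈ Finset.univ.filter (fun u : Finset (Fin d) => u.Nonempty), vitaliVariation f u

/-- `y` is a nearest neighbour of `s` among the points `x i` (ties may be broken in any way). -/
def IsNearestNeighbor {d n : ℕ} (x : Fin n → EuclideanSpace ℝ (Fin d))
    (s y : EuclideanSpace ℝ (Fin d)) : Prop :=
  (∃ i, y = x i) ∧ ∀ i, dist s y ≤ dist s (x i)

/-- `Z n i = O_p(r n)` as `n → ∞`, uniformly in `i`: for every `ε > 0` there is `M` such that,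
for all large `n`, with probability at least `1 - ε`, `|Z n i| ≤ M r n` for all `i` at once. -/
def UniformBigOInProbability {Ω : Type*} [MeasurableSpace Ω] (P : Measure Ω) {ι : Type*}
    (Z : ℕ → ι → Ω → ℝ) (r : ℕ → ℝ) : Prop :=
  ∀ ε : ℝ, 0 < ε → ∃ M : ℝ, ∀ᶠ n in atTop,
    P {ω | ∃ i, M * r n < |Z n i ω|} ≤ ENNReal.ofReal ε

end

/-!
The proof is a Koksma–Hlawka inequality for the subsample, together with a bound on its star
discrepancy.

*Koksma–Hlawka.* On a finite grid, the value of `f` at a grid point is a signed sum, over the faces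
through `(1,…,1)`, of the increments of `f` over the cells above the point (`grid_expansion`); both
sides are linear in `f`, so it suffices to expand a product of functions of one coordinate each.
Averaging `f` against signed weights of total mass zero and exchanging the sums, each increment is
multiplied by the weight of an anchored box, and the increments add up to at most the Hardy–Krause
variation (`abs_weightedSum_le`). Thus two samples of low discrepancy have nearly the same mean of
`f`. To compare with `∫ f`, choose one point in each cell of a regular partition of the cube such
that the value of `f` there is at least (or at most) its mean over the cell: these samples have
vanishing discrepancy, and `∫ f` is squeezed between their means (`abs_setIntegral_sub_mean_le`).
This needs no continuity of `f`, and the same discrete inequality bounds `f`, whence integrability.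

*Discrepancy of the subsample.* Moving the coordinates of the design points by at most `r` turns a
discrepancy `D` into at most `2 * D + d * r` (`abs_boxFraction_sub_prod_le_of_close`). The first `n`
sample points all avoid the `r`-neighbourhood of a design point with probability at most
`exp (-n * r ^ d)` (`measure_forall_notMem_coordNeighborhood_le`). For `r = K * q ^ (-(1 - δ))` and
`q = O(n ^ (1 / d))` one has `n * r ^ d ≥ L * q ^ (d * δ)` with `L` as large as desired, so that
even the sum of these probabilities over the `q` design points is small. Finally, almost surely all
sample points lie in `[0,1)^d`, where the discrepancy over half-open boxes sees every point.
-/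

/-! ### Expansion of a function on a grid into alternating sums -/

lemma alternatingSum_prod {d : ℕ} (h : Fin d → ℝ → ℝ) (u : Finset (Fin d)) (a b : Fin d → ℝ) :
    alternatingSum (fun x => ∏ j, h j (x j)) u a b =
      ∏ j, if j ∈ u then h j (b j) - h j (a j) else h j 1 := by
  have hsplit : ∀ g g' : Fin d → ℝ,
      (∏ j, if j ∈ u then g j else g' j) = (∏ j ∈ u, g j) * ∏ j ∈ uᶜ, g' j := by
    intro g g'
    rw [← Finset.prod_mul_prod_compl u]
    congr 1
    · exact Finset.prod_congr rfl fun j hj => if_pos hj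
    · exact Finset.prod_congr rfl fun j hj => if_neg (Finset.mem_compl.1 hj)
  rw [hsplit, Finset.prod_sub, Finset.sum_mul]
  refine Finset.sum_congr rfl fun v hv => ?_
  have hvu := Finset.mem_powerset.1 hv
  have key : (∏ j, h j (faceVertex u v a b j)) =
      ∏ j, if j ∈ u then (if j ∈ v then h j (a j) else h j (b j)) else h j 1 := by
    refine Finset.prod_congr rfl fun j _ => ?_
    by_cases h1 : j ∈ v
    · simp [faceVertex, h1, hvu h1]
    · by_cases h2 : j ∈ u <;> simp [faceVertex, h1, h2]
  beta_reduce
  rw [key, hsplit, ← Finset.prod_sdiff hvu]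
  rw [Finset.prod_congr rfl (g := fun j => h j (b j))
      (fun j hj => if_neg (Finset.mem_sdiff.1 hj).2),
    Finset.prod_congr rfl (g := fun j => h j (a j)) (fun j hj => if_pos hj)]
  ring

lemma sub_sum_increments_eq {m l : ℕ} (hl : l ≤ m) (g : ℕ → ℝ) :
    g m - ∑ k ∈ Finset.range m, (if l ≤ k then g (k + 1) - g k else 0) = g l := by
  have : (Finset.range m).filter (fun k => l ≤ k) = Finset.Ico l m := by
    ext k; simp [and_comm]
  rw [← Finset.sum_filter, this, Finset.sum_Ico_sub _ hl]
  ring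

lemma prod_grid_expansion {d m : ℕ} {y : Fin d → ℕ → ℝ} (hy : IsGrid m y)
    (h : Fin d → ℝ → ℝ) (l : Fin d → ℕ) (hl : ∀ j, l j ≤ m) :
    ∏ j, h j (y j (l j)) = ∑ u : Finset (Fin d), (-1 : ℝ) ^ u.card *
      ∑ k ∈ gridCells m u, (if ∀ j ∈ u, l j ≤ k j then (1 : ℝ) else 0) *
        alternatingSum (fun x => ∏ j, h j (x j)) u
          (fun j => y j (k j)) (fun j => y j (k j + 1)) := by
  have h1 : ∀ j, h j (y j (l j)) = h j 1 - ∑ k ∈ Finset.range m,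
      (if l j ≤ k then h j (y j (k + 1)) - h j (y j k) else 0) := by
    intro j
    have := sub_sum_increments_eq (hl j) (fun k => h j (y j k))
    simp only [(hy j).2.2] at this
    exact this.symm
  rw [Finset.prod_congr rfl fun j _ => h1 j, Finset.prod_sub, Finset.powerset_univ]
  refine Finset.sum_congr rfl fun u _ => ?_
  rw [mul_assoc]
  congr 1
  -- the product of sums over the coordinates in `u` is a sum over cells
  have h2 : ∀ k ∈ gridCells m u, (if ∀ j ∈ u, l j ≤ k j then (1 : ℝ) else 0) *
      alternatingSum (fun x => ∏ j, h j (x j)) u (fun j => y j (k j)) (fun j => y j (k j + 1)) =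
      ∏ j, (if j ∈ u then (if l j ≤ k j then h j (y j (k j + 1)) - h j (y j (k j)) else 0)
        else h j 1) := by
    intro k _
    rw [alternatingSum_prod]
    by_cases hk : ∀ j ∈ u, l j ≤ k j
    · rw [if_pos hk, one_mul]
      refine Finset.prod_congr rfl fun j _ => ?_
      by_cases hj : j ∈ u
      · simp [hj, hk j hj]
      · simp [hj]
    · rw [if_neg hk, zero_mul]
      push Not at hk
      obtain ⟨j, hj, hjk⟩ := hk
      refine (Finset.prod_eq_zero (Finset.mem_univ j) ?_).symm
      simp [hj, not_le.2 hjk]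
  rw [Finset.sum_congr rfl h2, gridCells]
  rw [← Finset.prod_univ_sum (fun j => if j ∈ u then Finset.range m else {0})
    (fun j k => if j ∈ u then (if l j ≤ k then h j (y j (k + 1)) - h j (y j k) else 0)
        else h j 1)]
  rw [← Finset.prod_mul_prod_compl u, mul_comm]
  rw [← Finset.compl_eq_univ_sdiff]
  congr 1
  · exact Finset.prod_congr rfl fun j hj => by simp [hj]
  · exact Finset.prod_congr rfl fun j hj => by simp [Finset.mem_compl.1 hj]

/-- The values of `f` on a grid, written as signed sums of its increments over the cells that lie
above the given grid point, on all faces through `(1,…,1)`. -/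
lemma grid_expansion {d m : ℕ} {y : Fin d → ℕ → ℝ} (hy : IsGrid m y)
    (hinj : ∀ j, Set.InjOn (y j) (Set.Iic m)) (f : EuclideanSpace ℝ (Fin d) → ℝ)
    (l : Fin d → ℕ) (hl : ∀ j, l j ≤ m) :
    f (WithLp.toLp 2 fun j => y j (l j)) = ∑ u : Finset (Fin d), (-1 : ℝ) ^ u.card *
      ∑ k ∈ gridCells m u, (if ∀ j ∈ u, l j ≤ k j then (1 : ℝ) else 0) *
        alternatingSum f u (fun j => y j (k j)) (fun j => y j (k j + 1)) := by
  -- on the grid `f` is a linear combination of products of functions of one coordinate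
  let G : Finset (Fin d → ℕ) := Fintype.piFinset fun _ => Finset.range (m + 1)
  let c : (Fin d → ℕ) → ℝ := fun r => f (WithLp.toLp 2 fun j => y j (r j))
  let e : (Fin d → ℕ) → Fin d → ℝ → ℝ := fun r j t => if t = y j (r j) then 1 else 0
  have hG : ∀ r : Fin d → ℕ, r ∈ G ↔ ∀ j, r j ≤ m := by
    intro r; simp [G]
  have hrep : ∀ r : Fin d → ℕ, (∀ j, r j ≤ m) →
      f (WithLp.toLp 2 fun j => y j (r j)) = ∑ r' ∈ G, c r' * ∏ j, e r' j (y j (r j)) := by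
    intro r hr
    rw [Finset.sum_eq_single_of_mem r ((hG r).2 hr)]
    · simp [c, e]
    · intro r' hr' hne
      obtain ⟨j, hj⟩ := Function.ne_iff.1 hne
      rw [Finset.prod_eq_zero (Finset.mem_univ j), mul_zero]
      refine if_neg fun h => hj ?_
      exact (hinj j (hr j) ((hG r').1 hr' j) h).symm
  have halt : ∀ u : Finset (Fin d), ∀ k ∈ gridCells m u,
      alternatingSum f u (fun j => y j (k j)) (fun j => y j (k j + 1)) =
        ∑ r' ∈ G, c r' * alternatingSum (fun x => ∏ j, e r' j (x j)) u
          (fun j => y j (k j)) (fun j => y j (k j + 1)) := by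
    intro u k hk
    have hk' : ∀ j ∈ u, k j < m := by
      intro j hj
      have := Fintype.mem_piFinset.1 hk j
      simpa [hj] using this
    simp only [alternatingSum, Finset.mul_sum]
    rw [Finset.sum_comm]
    refine Finset.sum_congr rfl fun v hv => ?_
    have hvu := Finset.mem_powerset.1 hv
    let r : Fin d → ℕ := fun j => if j ∈ v then k j else if j ∈ u then k j + 1 else m
    have hr : ∀ j, r j ≤ m := by
      intro j
      by_cases h1 : j ∈ v
      · simpa [r, h1] using (hk' j (hvu h1)).le
      · by_cases h2 : j ∈ u
        · simpa [r, h1, h2] using hk' j h2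
        · simp [r, h1, h2]
    have hv' : faceVertex u v (fun j => y j (k j)) (fun j => y j (k j + 1)) =
        WithLp.toLp 2 fun j => y j (r j) := by
      unfold faceVertex
      congr 1
      funext j
      by_cases h1 : j ∈ v
      · simp [r, h1]
      · by_cases h2 : j ∈ u
        · simp [r, h1, h2]
        · simp [r, h1, h2, (hy j).2.2]
    rw [hv', hrep r hr, Finset.mul_sum]
    refine Finset.sum_congr rfl fun r' _ => ?_
    ring
  rw [hrep l hl, Finset.sum_congr rfl fun r' _ => by rw [prod_grid_expansion hy (e r') l hl]]
  simp only [Finset.mul_sum]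
  rw [Finset.sum_comm]
  refine Finset.sum_congr rfl fun u _ => ?_
  rw [Finset.sum_comm]
  refine Finset.sum_congr rfl fun k hk => ?_
  rw [halt u k hk, Finset.mul_sum, Finset.mul_sum]
  refine Finset.sum_congr rfl fun r' _ => ?_
  ring

/-- Finitely many numbers of `[0,1]` lie on a common partition of `[0,1]`. -/
lemma exists_partition (A : Finset ℝ) (hA : ∀ a ∈ A, a ∈ Set.Icc (0 : ℝ) 1) :
    ∃ (m : ℕ) (y : ℕ → ℝ), Monotone y ∧ y 0 = 0 ∧ y m = 1 ∧ StrictMonoOn y (Set.Iic m) ∧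
      ∀ a ∈ A, ∃ l ≤ m, y l = a := by
  classical
  let B : Finset ℝ := insert 0 (insert 1 A)
  have hB : ∀ b ∈ B, b ∈ Set.Icc (0 : ℝ) 1 := by
    intro b hb
    simp only [B, Finset.mem_insert] at hb
    rcases hb with rfl | rfl | hb
    · simp
    · simp
    · exact hA b hb
  have h0 : (0 : ℝ) ∈ B := by simp [B]
  have h1 : (1 : ℝ) ∈ B := by simp [B]
  obtain ⟨m, hm⟩ : ∃ m, B.card = m + 1 :=
    Nat.exists_eq_succ_of_ne_zero (Finset.card_ne_zero_of_mem h0)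
  let o := B.orderEmbOfFin hm
  let y : ℕ → ℝ := fun l => o ⟨min l m, by omega⟩
  have hmono : Monotone y := fun a b hab => o.monotone (by simp; omega)
  have hex : ∀ b ∈ B, ∃ l ≤ m, y l = b := by
    intro b hb
    have : b ∈ Set.range o := by
      rw [Finset.range_orderEmbOfFin]; exact hb
    obtain ⟨i, rfl⟩ := this
    refine ⟨i, by omega, ?_⟩
    have : min (i : ℕ) m = i := by omega
    simp [y, this]
  have hyB : ∀ l, y l ∈ B := fun l => Finset.orderEmbOfFin_mem B hm _
  refine ⟨m, y, hmono, ?_, ?_, ?_, fun a ha => hex a (by simp [B, ha])⟩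
  · obtain ⟨l, _, h⟩ := hex 0 h0
    exact le_antisymm (h ▸ hmono (Nat.zero_le l)) (hB _ (hyB 0)).1
  · obtain ⟨l, hl, h⟩ := hex 1 h1
    exact le_antisymm (hB _ (hyB m)).2 (h ▸ hmono hl)
  · intro a ha b hb hab
    simp only [Set.mem_Iic] at ha hb
    refine o.strictMono ?_
    simp only [Fin.mk_lt_mk]
    omega

/-- The half-open unit cube `[0,1)^d`. -/
noncomputable def halfOpenCube (d : ℕ) : Set (EuclideanSpace ℝ (Fin d)) :=
  {x | ∀ j, x j ∈ Set.Ico (0 : ℝ) 1}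

/-- A discrete Koksma–Hlawka inequality for signed weights of total mass zero: if no anchored box
carries a weight above `D` in absolute value, then `f` integrates to at most `D` times its
Hardy–Krause variation. -/
lemma abs_weightedSum_le {d : ℕ} {κ : Type*} [Fintype κ] (p : κ → EuclideanSpace ℝ (Fin d))
    (hp : ∀ i, p i ∈ halfOpenCube d) (c : κ → ℝ) (hc : ∑ i, c i = 0) (D : ℝ) (hD0 : 0 ≤ D)
    (hD : ∀ a ∈ unitCube d, |∑ i, c i * (anchoredBox a).indicator (fun _ => (1 : ℝ)) (p i)| ≤ D)
    (f : EuclideanSpace ℝ (Fin d) → ℝ) (V : ℝ≥0) (hV : hardyKrauseVariation f ≤ V) :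
    |∑ i, c i * f (p i)| ≤ D * V := by
  classical
  -- a grid through all the points
  obtain ⟨m, y, hmono, hy0, hy1, hstrict, hex⟩ := exists_partition
    (Finset.univ.image fun ij : κ × Fin d => p ij.1 ij.2) (by
      intro a ha
      obtain ⟨ij, _, rfl⟩ := Finset.mem_image.1 ha
      exact Set.Ico_subset_Icc_self (hp ij.1 ij.2))
  have hex' : ∀ (i : κ) (j : Fin d), ∃ l ≤ m, y l = p i j := fun i j =>
    hex _ (Finset.mem_image.2 ⟨(i, j), Finset.mem_univ _, rfl⟩)
  choose l hlm hl using hex'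
  have hgrid : IsGrid m (fun _ : Fin d => y) := fun _ => ⟨hmono, hy0, hy1⟩
  have hfp : ∀ i, f (p i) = ∑ u : Finset (Fin d), (-1 : ℝ) ^ u.card *
      ∑ k ∈ gridCells m u, (if ∀ j ∈ u, l i j ≤ k j then (1 : ℝ) else 0) *
        alternatingSum f u (fun j => y (k j)) (fun j => y (k j + 1)) := by
    intro i
    rw [← grid_expansion hgrid (fun _ => hstrict.injOn) f (l i) (hlm i)]
    congr 1
    ext j
    simp [hl]
  let W : Finset (Fin d) → (Fin d → ℕ) → ℝ := fun u k =>
    ∑ i, c i * (if ∀ j ∈ u, l i j ≤ k j then (1 : ℝ) else 0)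
  have hsum : ∑ i, c i * f (p i) = ∑ u : Finset (Fin d), (-1 : ℝ) ^ u.card *
      ∑ k ∈ gridCells m u, W u k *
        alternatingSum f u (fun j => y (k j)) (fun j => y (k j + 1)) := by
    simp only [hfp, Finset.mul_sum, W, Finset.sum_mul]
    rw [Finset.sum_comm]
    refine Finset.sum_congr rfl fun u _ => ?_
    rw [Finset.sum_comm]
    refine Finset.sum_congr rfl fun k _ => Finset.sum_congr rfl fun i _ => ?_
    ring
  -- the points below a cell are those of a box anchored at the origin
  have hW : ∀ u, ∀ k ∈ gridCells m u, |W u k| ≤ D := by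
    intro u k hk
    have hk' : ∀ j ∈ u, k j < m := by
      intro j hj
      have := Fintype.mem_piFinset.1 hk j
      simpa [hj] using this
    let a : EuclideanSpace ℝ (Fin d) := WithLp.toLp 2 fun j => if j ∈ u then y (k j + 1) else 1
    have ha : a ∈ unitCube d := by
      intro j
      by_cases hj : j ∈ u
      · simp only [a, hj, if_true]
        exact ⟨hy0 ▸ hmono (Nat.zero_le _), hy1 ▸ hmono (hk' j hj)⟩
      · simp [a, hj]
    refine le_of_eq_of_le ?_ (hD a ha)
    congr 1
    refine Finset.sum_congr rfl fun i _ => ?_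
    congr 1
    have : p i ∈ anchoredBox a ↔ ∀ j ∈ u, l i j ≤ k j := by
      constructor
      · intro h j hj
        have h2 := (h j).2
        simp only [a, hj, if_true, ← hl] at h2
        exact Nat.lt_succ_iff.1 (hmono.reflect_lt h2)
      · intro h j
        refine ⟨(hp i j).1, ?_⟩
        by_cases hj : j ∈ u
        · simp only [a, hj, if_true, ← hl]
          exact hstrict (hlm i j) (hk' j hj) (Nat.lt_succ_iff.2 (h j hj))
        · simpa [a, hj] using (hp i j).2
    by_cases h : ∀ j ∈ u, l i j ≤ k j
    · rw [if_pos h, Set.indicator_of_mem (this.2 h)]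
    · rw [if_neg h, Set.indicator_of_notMem (fun h' => h (this.1 h'))]
  have hW0 : ∀ k, W ∅ k = 0 := by intro k; simp [W, hc]
  let v : Finset (Fin d) → ℝ := fun u => ∑ k ∈ gridCells m u,
    |alternatingSum f u (fun j => y (k j)) (fun j => y (k j + 1))|
  have hterm : ∀ u : Finset (Fin d), |(-1 : ℝ) ^ u.card *
      ∑ k ∈ gridCells m u, W u k *
        alternatingSum f u (fun j => y (k j)) (fun j => y (k j + 1))| ≤
      if u.Nonempty then D * v u else 0 := by
    intro u
    rw [abs_mul, abs_pow, abs_neg, abs_one, one_pow, one_mul]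
    by_cases hu : u.Nonempty
    · rw [if_pos hu, Finset.mul_sum]
      refine (Finset.abs_sum_le_sum_abs _ _).trans (Finset.sum_le_sum fun k hk => ?_)
      rw [abs_mul]
      exact mul_le_mul_of_nonneg_right (hW u k hk) (abs_nonneg _)
    · rw [Finset.not_nonempty_iff_eq_empty.1 hu]
      simp [hW0]
  have hvV : ∑ u ∈ Finset.univ.filter (fun u : Finset (Fin d) => u.Nonempty), v u ≤ V := by
    have h1 : ENNReal.ofReal
        (∑ u ∈ Finset.univ.filter (fun u : Finset (Fin d) => u.Nonempty), v u) ≤ V := by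
      refine le_trans ?_ hV
      rw [ENNReal.ofReal_sum_of_nonneg
        (fun u _ => Finset.sum_nonneg fun k _ => abs_nonneg _)]
      refine Finset.sum_le_sum fun u _ => ?_
      rw [ENNReal.ofReal_sum_of_nonneg (fun k _ => abs_nonneg _)]
      exact le_iSup_of_le m (le_iSup_of_le (fun _ => y) (le_iSup_of_le hgrid le_rfl))
    rw [← ENNReal.ofReal_coe_nnreal] at h1
    exact (ENNReal.ofReal_le_ofReal_iff V.2).1 h1
  calc |∑ i, c i * f (p i)| ≤ ∑ u : Finset (Fin d), if u.Nonempty then D * v u else 0 := by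
        rw [hsum]
        exact (Finset.abs_sum_le_sum_abs _ _).trans (Finset.sum_le_sum fun u _ => hterm u)
    _ = D * ∑ u ∈ Finset.univ.filter (fun u : Finset (Fin d) => u.Nonempty), v u := by
        rw [← Finset.sum_filter, Finset.mul_sum]
    _ ≤ D * V := mul_le_mul_of_nonneg_left hvV hD0

/-! ### Discrepancy of perturbed point sets and of lattices -/

lemma abs_prod_sub_prod_le {κ : Type*} (J : Finset κ) {x y : κ → ℝ} {r : ℝ}
    (hx : ∀ j, x j ∈ Set.Icc (0 : ℝ) 1) (hy : ∀ j, y j ∈ Set.Icc (0 : ℝ) 1)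
    (h : ∀ j, |x j - y j| ≤ r) : |∏ j ∈ J, x j - ∏ j ∈ J, y j| ≤ J.card * r := by
  classical
  induction J using Finset.induction_on with
  | empty => simp
  | insert i J hi ih =>
    rw [Finset.prod_insert hi, Finset.prod_insert hi, Finset.card_insert_of_notMem hi]
    have hP0 : 0 ≤ ∏ j ∈ J, y j := Finset.prod_nonneg fun j _ => (hy j).1
    have hP1 : ∏ j ∈ J, y j ≤ 1 := Finset.prod_le_one (fun j _ => (hy j).1) fun j _ => (hy j).2
    have e : x i * ∏ j ∈ J, x j - y i * ∏ j ∈ J, y j =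
        x i * (∏ j ∈ J, x j - ∏ j ∈ J, y j) + (x i - y i) * ∏ j ∈ J, y j := by ring
    rw [e]
    refine (abs_add_le _ _).trans ?_
    rw [abs_mul, abs_mul, abs_of_nonneg (hx i).1, abs_of_nonneg hP0]
    have h1 : x i * |∏ j ∈ J, x j - ∏ j ∈ J, y j| ≤ 1 * (J.card * r) :=
      mul_le_mul (hx i).2 ih (abs_nonneg _) zero_le_one
    have h2 : |x i - y i| * ∏ j ∈ J, y j ≤ r * 1 :=
      mul_le_mul (h i) hP1 hP0 ((abs_nonneg _).trans (h i))
    push_cast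
    linarith

/-- The proportion of the points `t` that lie in the box `[0,a)`. -/
noncomputable def boxFraction {d : ℕ} {κ : Type*} [Fintype κ] (t : κ → EuclideanSpace ℝ (Fin d))
    (a : EuclideanSpace ℝ (Fin d)) : ℝ :=
  (1 / (Fintype.card κ : ℝ)) * ∑ i, (anchoredBox a).indicator (fun _ => (1 : ℝ)) (t i)

lemma boxFraction_mem_Icc {d : ℕ} {κ : Type*} [Fintype κ] (t : κ → EuclideanSpace ℝ (Fin d))
    (a : EuclideanSpace ℝ (Fin d)) : boxFraction t a ∈ Set.Icc (0 : ℝ) 1 := by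
  have h0 : ∀ i, 0 ≤ (anchoredBox a).indicator (fun _ => (1 : ℝ)) (t i) := fun i =>
    Set.indicator_nonneg (fun _ _ => zero_le_one) _
  have h1 : ∑ i, (anchoredBox a).indicator (fun _ => (1 : ℝ)) (t i) ≤ Fintype.card κ := by
    refine (Finset.sum_le_sum fun i _ =>
      Set.indicator_le_self' (fun _ _ => zero_le_one) (t i)).trans ?_
    simp
  refine ⟨mul_nonneg (by positivity) (Finset.sum_nonneg fun i _ => h0 i), ?_⟩
  rw [boxFraction, one_div, inv_mul_eq_div]
  exact div_le_one_of_le₀ h1 (by positivity)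

lemma prod_mem_Icc {d : ℕ} {a : EuclideanSpace ℝ (Fin d)} (ha : a ∈ unitCube d) :
    ∏ j, a j ∈ Set.Icc (0 : ℝ) 1 :=
  ⟨Finset.prod_nonneg fun j _ => (ha j).1,
    Finset.prod_le_one (fun j _ => (ha j).1) fun j _ => (ha j).2⟩

lemma indicator_anchoredBox_le {d : ℕ} {a b x z : EuclideanSpace ℝ (Fin d)}
    (h : x ∈ anchoredBox a → z ∈ anchoredBox b) :
    (anchoredBox a).indicator (fun _ => (1 : ℝ)) x ≤
      (anchoredBox b).indicator (fun _ => (1 : ℝ)) z := by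
  by_cases hx : x ∈ anchoredBox a
  · rw [Set.indicator_of_mem hx, Set.indicator_of_mem (h hx)]
  · rw [Set.indicator_of_notMem hx]
    exact Set.indicator_nonneg (fun _ _ => zero_le_one) _

/-- Moving every coordinate of every point by at most `r` keeps the discrepancy under control.
The factor `2` accounts for points of `s` on the faces where some coordinate is `1`: no anchored box
contains them, and there are few of them because the box `[0,1)^d` misses them. -/
lemma abs_boxFraction_sub_prod_le_of_close {d : ℕ} {κ : Type*} [Fintype κ] [Nonempty κ]
    {s t : κ → EuclideanSpace ℝ (Fin d)} (hs : ∀ i, s i ∈ unitCube d)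
    (ht : ∀ i, t i ∈ unitCube d) {r : ℝ} (hst : ∀ i j, |s i j - t i j| ≤ r) {D : ℝ}
    (hD : ∀ a ∈ unitCube d, |boxFraction s a - ∏ j, a j| ≤ D)
    {a : EuclideanSpace ℝ (Fin d)} (ha : a ∈ unitCube d) :
    |boxFraction t a - ∏ j, a j| ≤ 2 * D + d * r := by
  have hcard : (0 : ℝ) < Fintype.card κ := by exact_mod_cast Fintype.card_pos
  have hD0 : 0 ≤ D := (abs_nonneg _).trans (hD a ha)
  by_cases hd : Nonempty (Fin d)
  swap
  -- for `d = 0` the number `r` may be negative, but there is only one point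
  · have : IsEmpty (Fin d) := not_nonempty_iff.1 hd
    have e : boxFraction t a = boxFraction s a := by
      unfold boxFraction
      congr 2
      funext i
      rw [Subsingleton.elim (t i) (s i)]
    have hd0 : d = 0 := Nat.eq_zero_of_not_pos fun h => this.false ⟨0, h⟩
    have := hD a ha
    rw [e]
    subst hd0
    simp only [Nat.cast_zero, zero_mul] at *
    linarith
  have hr : 0 ≤ r := (abs_nonneg _).trans (hst (Classical.arbitrary κ) hd.some)
  let b : EuclideanSpace ℝ (Fin d) := WithLp.toLp 2 fun j => min (a j + r) 1
  let c : EuclideanSpace ℝ (Fin d) := WithLp.toLp 2 fun j => max (a j - r) 0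
  let o : EuclideanSpace ℝ (Fin d) := WithLp.toLp 2 fun _ => 1
  have hb : b ∈ unitCube d := fun j =>
    ⟨le_min (by have := (ha j).1; linarith) zero_le_one, min_le_right _ _⟩
  have hc : c ∈ unitCube d := fun j =>
    ⟨le_max_right _ _, max_le (by have := (ha j).2; linarith) zero_le_one⟩
  have ho : o ∈ unitCube d := fun j => by simp [o]
  have hab : |∏ j, b j - ∏ j, a j| ≤ d * r := by
    have := abs_prod_sub_prod_le Finset.univ hb ha (r := r) (by
      intro j
      have h1 := (ha j).2
      simp only [b]
      rw [abs_of_nonneg (sub_nonneg.2 (le_min (by linarith) h1))]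
      linarith [min_le_left (a j + r) 1])
    simpa using this
  have hac : |∏ j, c j - ∏ j, a j| ≤ d * r := by
    have := abs_prod_sub_prod_le Finset.univ hc ha (r := r) (by
      intro j
      have h1 := (ha j).1
      simp only [c]
      rw [abs_of_nonpos (sub_nonpos.2 (max_le (by linarith) h1))]
      linarith [le_max_left (a j - r) 0])
    simpa using this
  have hub : boxFraction t a ≤ boxFraction s b + (1 - boxFraction s o) := by
    have e : boxFraction s b + (1 - boxFraction s o) = (1 / (Fintype.card κ : ℝ)) *
        ∑ i, ((anchoredBox b).indicator (fun _ => (1 : ℝ)) (s i) +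
          (1 - (anchoredBox o).indicator (fun _ => (1 : ℝ)) (s i))) := by
      unfold boxFraction
      rw [Finset.sum_add_distrib, Finset.sum_sub_distrib]
      simp only [Finset.sum_const, Finset.card_univ, nsmul_eq_mul, mul_one]
      field_simp
    rw [e]
    refine mul_le_mul_of_nonneg_left (Finset.sum_le_sum fun i _ => ?_) (by positivity)
    by_cases hio : s i ∈ anchoredBox o
    · rw [Set.indicator_of_mem hio, sub_self, add_zero]
      refine indicator_anchoredBox_le fun hi j => ⟨(hs i j).1, ?_⟩
      have h1 := (hi j).2
      have h2 := (hio j).2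
      have h3 := (abs_le.1 (hst i j)).2
      exact lt_min (by linarith) h2
    · rw [Set.indicator_of_notMem hio, sub_zero]
      have h1 : (anchoredBox a).indicator (fun _ => (1 : ℝ)) (t i) ≤ 1 :=
        Set.indicator_le_self' (fun _ _ => zero_le_one) (t i)
      have h2 : 0 ≤ (anchoredBox b).indicator (fun _ => (1 : ℝ)) (s i) :=
        Set.indicator_nonneg (fun _ _ => zero_le_one) _
      linarith
  have hlb : boxFraction s c ≤ boxFraction t a := by
    refine mul_le_mul_of_nonneg_left (Finset.sum_le_sum fun i _ => ?_) (by positivity)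
    refine indicator_anchoredBox_le fun hi j => ⟨(ht i j).1, ?_⟩
    have h1 := (hi j).2
    have h2 := (hi j).1
    have h3 := (abs_le.1 (hst i j)).1
    simp only [c] at h1
    rcases lt_max_iff.1 h1 with h1 | h1 <;> linarith
  have h1 := abs_le.1 (hD b hb)
  have h2 := abs_le.1 (hD c hc)
  have h3 := abs_le.1 (hD o ho)
  have ho1 : ∏ j, o j = 1 := by simp [o]
  rw [ho1] at h3
  rw [abs_le] at hab hac
  rw [abs_le]
  constructor <;> linarith [h1.2, h2.1, h3.1, hab.2, hac.1]

/-- The lattice of the lower corners of the `N ^ d` cells of side `1 / N`. -/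
noncomputable def cellCorner {d N : ℕ} (k : Fin d → Fin N) : EuclideanSpace ℝ (Fin d) :=
  WithLp.toLp 2 fun j => (k j : ℝ) / N

lemma cellCorner_mem {d N : ℕ} (k : Fin d → Fin N) : cellCorner k ∈ halfOpenCube d := by
  intro j
  have hN : (0 : ℝ) < N := by exact_mod_cast (k j).pos
  simp only [cellCorner]
  exact ⟨by positivity, (div_lt_one hN).2 (by exact_mod_cast (k j).2)⟩

lemma abs_boxFraction_cellCorner_sub_prod_le {d N : ℕ} (hN : 0 < N)
    {a : EuclideanSpace ℝ (Fin d)} (ha : a ∈ unitCube d) :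
    |boxFraction (cellCorner : (Fin d → Fin N) → _) a - ∏ j, a j| ≤ d * (1 / N) := by
  have hN' : (0 : ℝ) < N := by exact_mod_cast hN
  have hceil : ∀ j, ⌈a j * N⌉₊ ≤ N := by
    intro j
    refine Nat.ceil_le.2 ?_
    have := (ha j).2
    nlinarith
  have hcount : ∀ j, ∑ i : Fin N, (if (i : ℕ) < ⌈a j * N⌉₊ then (1 : ℝ) else 0) = ⌈a j * N⌉₊ := by
    intro j
    rw [Fin.sum_univ_eq_sum_range (fun i => if i < ⌈a j * N⌉₊ then (1 : ℝ) else 0) N,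
      ← Finset.sum_filter]
    have : (Finset.range N).filter (fun i => i < ⌈a j * N⌉₊) = Finset.range ⌈a j * N⌉₊ := by
      ext i
      have := hceil j
      simp only [Finset.mem_filter, Finset.mem_range]
      omega
    rw [this]
    simp
  have hfrac : boxFraction (cellCorner : (Fin d → Fin N) → _) a =
      ∏ j, (⌈a j * N⌉₊ : ℝ) / N := by
    have hind : ∀ k : Fin d → Fin N, (anchoredBox a).indicator (fun _ => (1 : ℝ)) (cellCorner k) =
        ∏ j, if (k j : ℕ) < ⌈a j * N⌉₊ then (1 : ℝ) else 0 := by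
      intro k
      have hmem : cellCorner k ∈ anchoredBox a ↔ ∀ j, (k j : ℕ) < ⌈a j * N⌉₊ := by
        refine forall_congr' fun j => ?_
        rw [Nat.lt_ceil]
        simp only [cellCorner, Set.mem_Ico, div_lt_iff₀ hN']
        exact and_iff_right (by positivity)
      by_cases h : ∀ j, (k j : ℕ) < ⌈a j * N⌉₊
      · rw [Set.indicator_of_mem (hmem.2 h)]
        exact (Finset.prod_eq_one fun j _ => if_pos (h j)).symm
      · rw [Set.indicator_of_notMem fun h' => h (hmem.1 h')]
        push Not at h
        obtain ⟨j, hj⟩ := h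
        exact (Finset.prod_eq_zero (Finset.mem_univ j) (if_neg (not_lt.2 hj))).symm
    rw [boxFraction, Finset.sum_congr rfl fun k _ => hind k,
      ← Fintype.prod_sum (fun j (i : Fin N) => if (i : ℕ) < ⌈a j * N⌉₊ then (1 : ℝ) else 0),
      Finset.prod_congr rfl fun j _ => hcount j, Finset.prod_div_distrib]
    simp
    ring
  rw [hfrac]
  have := abs_prod_sub_prod_le (Finset.univ : Finset (Fin d)) (r := 1 / (N : ℝ))
    (x := fun j => (⌈a j * N⌉₊ : ℝ) / N) (y := fun j => a j)
    (fun j => ⟨by positivity, (div_le_one hN').2 (by exact_mod_cast hceil j)⟩) ha (by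
      intro j
      have h0 : 0 ≤ a j * N := mul_nonneg (ha j).1 hN'.le
      have h1 := Nat.le_ceil (a j * N)
      have h2 := (Nat.ceil_lt_add_one h0).le
      have e : (⌈a j * N⌉₊ : ℝ) / N - a j = (⌈a j * N⌉₊ - a j * N) / N := by field_simp
      rw [e, abs_of_nonneg (div_nonneg (by linarith) hN'.le)]
      gcongr
      linarith)
  simpa using this

/-! ### The Koksma–Hlawka inequality -/

lemma measurableSet_coordBox {d : ℕ} {S : Fin d → Set ℝ} (hS : ∀ j, MeasurableSet (S j)) :
    MeasurableSet {x : EuclideanSpace ℝ (Fin d) | ∀ j, x j ∈ S j} := by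
  rw [Set.ofPred_forall]
  exact MeasurableSet.iInter fun j => hS j |>.preimage (by fun_prop)

lemma volume_coordBox {d : ℕ} {S : Fin d → Set ℝ} (hS : ∀ j, MeasurableSet (S j)) :
    volume {x : EuclideanSpace ℝ (Fin d) | ∀ j, x j ∈ S j} = ∏ j, volume (S j) := by
  have h := (PiLp.volume_preserving_ofLp (Fin d)).measure_preimage
    (MeasurableSet.univ_pi hS).nullMeasurableSet
  rw [volume_pi_pi] at h
  rw [← h]
  congr 1
  ext x
  simp

lemma volume_unitCube (d : ℕ) : volume (unitCube d) = 1 := by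
  rw [unitCube, volume_coordBox fun _ => measurableSet_Icc]
  simp

lemma volume_halfOpenCube (d : ℕ) : volume (halfOpenCube d) = 1 := by
  rw [halfOpenCube, volume_coordBox fun _ => measurableSet_Ico]
  simp

lemma measurableSet_unitCube (d : ℕ) : MeasurableSet (unitCube d) :=
  measurableSet_coordBox fun _ => measurableSet_Icc

lemma measurableSet_halfOpenCube (d : ℕ) : MeasurableSet (halfOpenCube d) :=
  measurableSet_coordBox fun _ => measurableSet_Ico

lemma halfOpenCube_subset_unitCube (d : ℕ) : halfOpenCube d ⊆ unitCube d :=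
  fun _ hx j => Set.Ico_subset_Icc_self (hx j)

lemma halfOpenCube_ae_eq_unitCube (d : ℕ) :
    halfOpenCube d =ᵐ[volume] unitCube d :=
  ae_eq_of_subset_of_measure_ge (halfOpenCube_subset_unitCube d)
    (by rw [volume_unitCube, volume_halfOpenCube])
    (measurableSet_halfOpenCube d).nullMeasurableSet (by simp [volume_unitCube])

/-- Two samples in `[0,1)^d` of low discrepancy have nearly the same mean of `f`. -/
lemma abs_mean_sub_mean_le {d : ℕ} {κ κ' : Type*} [Fintype κ] [Nonempty κ] [Fintype κ']
    [Nonempty κ'] {t : κ → EuclideanSpace ℝ (Fin d)} {w : κ' → EuclideanSpace ℝ (Fin d)}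
    (ht : ∀ i, t i ∈ halfOpenCube d) (hw : ∀ i, w i ∈ halfOpenCube d) {D D' : ℝ}
    (hD0 : 0 ≤ D) (hD0' : 0 ≤ D')
    (hD : ∀ a ∈ unitCube d, |boxFraction t a - ∏ j, a j| ≤ D)
    (hD' : ∀ a ∈ unitCube d, |boxFraction w a - ∏ j, a j| ≤ D')
    (f : EuclideanSpace ℝ (Fin d) → ℝ) (V : ℝ≥0) (hV : hardyKrauseVariation f ≤ V) :
    |(1 / (Fintype.card κ' : ℝ)) * ∑ i, f (w i) - (1 / (Fintype.card κ : ℝ)) * ∑ i, f (t i)| ≤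
      (D + D') * V := by
  have hcard : (Fintype.card κ : ℝ) ≠ 0 := by exact_mod_cast Fintype.card_ne_zero
  have hcard' : (Fintype.card κ' : ℝ) ≠ 0 := by exact_mod_cast Fintype.card_ne_zero
  have hsum : ∀ g : EuclideanSpace ℝ (Fin d) → ℝ,
      ∑ i, (Sum.elim (fun _ : κ' => 1 / (Fintype.card κ' : ℝ))
        (fun _ : κ => -(1 / (Fintype.card κ : ℝ))) i) * g (Sum.elim w t i) =
      (1 / (Fintype.card κ' : ℝ)) * ∑ i, g (w i) -
        (1 / (Fintype.card κ : ℝ)) * ∑ i, g (t i) := by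
    intro g
    simp only [Fintype.sum_sum_type, Sum.elim_inl, Sum.elim_inr, ← Finset.mul_sum, neg_mul,
      Finset.sum_neg_distrib]
    ring
  rw [← hsum]
  refine abs_weightedSum_le (Sum.elim w t) ?_ _ ?_ (D + D') (by positivity) ?_ f V hV
  · rintro (i | i)
    · exact hw i
    · exact ht i
  · have := hsum fun _ => 1
    simp only [mul_one] at this
    rw [this]
    simp [hcard, hcard']
  · intro a ha
    rw [hsum]
    have h1 := hD a ha
    have h2 := hD' a ha
    unfold boxFraction at h1 h2
    rw [abs_le] at *
    constructor <;> linarith [h1.1, h1.2, h2.1, h2.2]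

lemma abs_sub_le_of_hardyKrauseVariation_le {d : ℕ} {f : EuclideanSpace ℝ (Fin d) → ℝ} {V : ℝ≥0}
    (hV : hardyKrauseVariation f ≤ V) {x z : EuclideanSpace ℝ (Fin d)}
    (hx : x ∈ halfOpenCube d) (hz : z ∈ halfOpenCube d) : |f x - f z| ≤ V := by
  have hs : ∀ g : EuclideanSpace ℝ (Fin d) → ℝ,
      ∑ i, (![1, -1] : Fin 2 → ℝ) i * g (![x, z] i) = g x - g z := by
    intro g; simp [Fin.sum_univ_two]; ring
  have := abs_weightedSum_le ![x, z] (by intro i; fin_cases i <;> simpa) ![1, -1]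
    (by simp [Fin.sum_univ_two]) 1 zero_le_one (by
      intro a _
      rw [hs]
      have h0 : ∀ z, 0 ≤ (anchoredBox a).indicator (fun _ => (1 : ℝ)) z := fun z =>
        Set.indicator_nonneg (fun _ _ => zero_le_one) _
      have h1 : ∀ z, (anchoredBox a).indicator (fun _ => (1 : ℝ)) z ≤ 1 := fun z =>
        Set.indicator_le_self' (fun _ _ => zero_le_one) z
      rw [abs_le]
      constructor <;> linarith [h0 x, h0 z, h1 x, h1 z]) f V hV
  rwa [hs, one_mul] at this

lemma integrableOn_of_hardyKrauseVariation_le {d : ℕ} {f : EuclideanSpace ℝ (Fin d) → ℝ}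
    (hf : AEStronglyMeasurable f (volume.restrict (unitCube d))) {V : ℝ≥0}
    (hV : hardyKrauseVariation f ≤ V) : IntegrableOn f (unitCube d) volume := by
  have h0 : (WithLp.toLp 2 fun _ => 0 : EuclideanSpace ℝ (Fin d)) ∈ halfOpenCube d := by
    intro j; simp
  have : IsFiniteMeasure (volume.restrict (unitCube d)) := ⟨by simp [volume_unitCube]⟩
  refine Integrable.of_bound hf (|f (WithLp.toLp 2 fun _ => 0)| + V) ?_
  rw [← Measure.restrict_congr_set (halfOpenCube_ae_eq_unitCube d)]
  filter_upwards [ae_restrict_mem (measurableSet_halfOpenCube d)] with x hx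
  have := abs_sub_le_of_hardyKrauseVariation_le hV hx h0
  rw [Real.norm_eq_abs]
  linarith [abs_sub_abs_le_abs_sub (f x) (f (WithLp.toLp 2 fun _ => 0))]

/-- The half-open cell of side `1 / N` with lower corner `cellCorner k`. -/
def cell {d N : ℕ} (k : Fin d → Fin N) : Set (EuclideanSpace ℝ (Fin d)) :=
  {x | ∀ j, x j ∈ Set.Ico ((k j : ℝ) / N) (((k j : ℝ) + 1) / N)}

lemma measurableSet_cell {d N : ℕ} (k : Fin d → Fin N) : MeasurableSet (cell k) :=
  measurableSet_coordBox fun _ => measurableSet_Ico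

lemma volume_cell {d N : ℕ} (hN : 0 < N) (k : Fin d → Fin N) :
    volume (cell k) = ENNReal.ofReal ((1 / N : ℝ) ^ d) := by
  rw [cell, volume_coordBox fun _ => measurableSet_Ico]
  have : ∀ j, volume (Set.Ico ((k j : ℝ) / N) (((k j : ℝ) + 1) / N)) =
      ENNReal.ofReal (1 / N : ℝ) := by
    intro j
    rw [Real.volume_Ico]
    congr 1
    ring
  rw [Finset.prod_congr rfl fun j _ => this j, ENNReal.ofReal_pow (by positivity)]
  simp

lemma mem_cell_iff {d N : ℕ} (hN : 0 < N) {k : Fin d → Fin N} {x : EuclideanSpace ℝ (Fin d)} :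
    x ∈ cell k ↔ ∀ j, 0 ≤ x j ∧ ⌊x j * N⌋₊ = k j := by
  have hN' : (0 : ℝ) < N := by exact_mod_cast hN
  refine forall_congr' fun j => ?_
  rw [Set.mem_Ico, div_le_iff₀ hN', lt_div_iff₀ hN']
  constructor
  · rintro ⟨h1, h2⟩
    have h0 : 0 ≤ x j * N := le_trans (by positivity) h1
    exact ⟨nonneg_of_mul_nonneg_left h0 hN', (Nat.floor_eq_iff h0).2 ⟨h1, h2⟩⟩
  · rintro ⟨h0, h1⟩
    exact (Nat.floor_eq_iff (mul_nonneg h0 hN'.le)).1 h1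

lemma iUnion_cell {d N : ℕ} (hN : 0 < N) :
    ⋃ k : Fin d → Fin N, cell k = halfOpenCube d := by
  have hN' : (0 : ℝ) < N := by exact_mod_cast hN
  ext x
  rw [Set.mem_iUnion]
  constructor
  · rintro ⟨k, hk⟩ j
    have h1 := (hk j).1
    have h2 := (hk j).2
    refine ⟨le_trans (by positivity) h1, h2.trans_le ((div_le_one hN').2 ?_)⟩
    exact_mod_cast (k j).2
  · intro hx
    refine ⟨fun j => ⟨⌊x j * N⌋₊, ?_⟩, (mem_cell_iff hN).2 fun j => ⟨(hx j).1, rfl⟩⟩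
    rw [Nat.floor_lt (mul_nonneg (hx j).1 hN'.le)]
    have := (hx j).2
    nlinarith

lemma pairwise_disjoint_cell {d N : ℕ} (hN : 0 < N) :
    Pairwise (Function.onFun Disjoint (cell : (Fin d → Fin N) → Set _)) := by
  intro k k' hne
  refine Set.disjoint_left.2 fun x hx hx' => hne ?_
  funext j
  exact Fin.ext (((mem_cell_iff hN).1 hx j).2.symm.trans ((mem_cell_iff hN).1 hx' j).2)

lemma setIntegral_unitCube_eq_sum_cell {d N : ℕ} (hN : 0 < N)
    {f : EuclideanSpace ℝ (Fin d) → ℝ} (hf : IntegrableOn f (unitCube d) volume) :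
    ∫ x in unitCube d, f x = ∑ k : Fin d → Fin N, ∫ x in cell k, f x := by
  rw [← setIntegral_congr_set (halfOpenCube_ae_eq_unitCube d), ← iUnion_cell hN]
  refine integral_iUnion_fintype measurableSet_cell (pairwise_disjoint_cell hN) fun k => ?_
  refine hf.mono_set (subset_trans ?_ (halfOpenCube_subset_unitCube d))
  rw [← iUnion_cell hN]
  exact Set.subset_iUnion _ k

lemma abs_boxFraction_sub_prod_le_of_mem_cell {d N : ℕ} (hN : 0 < N)
    {w : (Fin d → Fin N) → EuclideanSpace ℝ (Fin d)} (hw : ∀ k, w k ∈ cell k)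
    {a : EuclideanSpace ℝ (Fin d)} (ha : a ∈ unitCube d) :
    |boxFraction w a - ∏ j, a j| ≤ 3 * d * (1 / N) := by
  have : Nonempty (Fin d → Fin N) := ⟨fun _ => ⟨0, hN⟩⟩
  have hw' : ∀ k, w k ∈ unitCube d := fun k =>
    halfOpenCube_subset_unitCube d (iUnion_cell hN ▸ Set.mem_iUnion.2 ⟨k, hw k⟩)
  refine (abs_boxFraction_sub_prod_le_of_close (r := 1 / (N : ℝ))
    (fun k => halfOpenCube_subset_unitCube d (cellCorner_mem k)) hw' ?_
    (fun a ha => abs_boxFraction_cellCorner_sub_prod_le hN ha) ha).trans_eq (by ring)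
  intro k j
  have h1 := (hw k j).1
  have h2 := (hw k j).2
  rw [add_div] at h2
  simp only [cellCorner]
  rw [abs_le]
  constructor <;> linarith [show (0 : ℝ) ≤ 1 / N by positivity]

/-- The Koksma–Hlawka inequality. No regularity of `f` beyond measurability is needed: in each cell
of side `1 / N` some value of `f` is at least, and some value at most, the mean of `f` over the
cell, so `∫ f` lies between the means of `f` over two samples whose discrepancy tends to `0`. -/
lemma abs_setIntegral_sub_mean_le {d : ℕ} {κ : Type*} [Fintype κ] [Nonempty κ]
    {t : κ → EuclideanSpace ℝ (Fin d)} (ht : ∀ i, t i ∈ halfOpenCube d) {D : ℝ}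
    (hD : ∀ a ∈ unitCube d, |boxFraction t a - ∏ j, a j| ≤ D)
    {f : EuclideanSpace ℝ (Fin d) → ℝ}
    (hf : AEStronglyMeasurable f (volume.restrict (unitCube d))) {V : ℝ≥0}
    (hV : hardyKrauseVariation f ≤ V) :
    |(∫ x in unitCube d, f x) - (1 / (Fintype.card κ : ℝ)) * ∑ i, f (t i)| ≤ D * V := by
  have hint := integrableOn_of_hardyKrauseVariation_le hf hV
  have hD0 : 0 ≤ D := (abs_nonneg _).trans
    (hD _ (halfOpenCube_subset_unitCube d (ht (Classical.arbitrary κ))))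
  have key : ∀ n : ℕ, |(∫ x in unitCube d, f x) - (1 / (Fintype.card κ : ℝ)) * ∑ i, f (t i)| ≤
      (D + 3 * d * (1 / ((n : ℝ) + 1))) * V := by
    intro n
    have hN : 0 < n + 1 := n.succ_pos
    have hNonempty : Nonempty (Fin d → Fin (n + 1)) := ⟨fun _ => 0⟩
    have hcell : ∀ k : Fin d → Fin (n + 1), cell k ⊆ halfOpenCube d := fun k =>
      iUnion_cell hN ▸ Set.subset_iUnion _ k
    have hmean : ∀ w : (Fin d → Fin (n + 1)) → EuclideanSpace ℝ (Fin d), (∀ k, w k ∈ cell k) →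
        |∑ k, (1 / ((n + 1 : ℕ) : ℝ)) ^ d * f (w k) -
          (1 / (Fintype.card κ : ℝ)) * ∑ i, f (t i)| ≤ (D + 3 * d * (1 / ((n : ℝ) + 1))) * V := by
      intro w hw
      have h := abs_mean_sub_mean_le ht (fun k => hcell k (hw k)) hD0 (by positivity) hD
        (fun a ha => abs_boxFraction_sub_prod_le_of_mem_cell hN hw ha) f V hV
      rw [← Finset.mul_sum]
      convert h using 4
      · simp
      · simp
    have hvol : ∀ k : Fin d → Fin (n + 1), volume.real (cell k) = (1 / ((n + 1 : ℕ) : ℝ)) ^ d := by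
      intro k
      rw [Measure.real, volume_cell hN, ENNReal.toReal_ofReal (by positivity)]
    have hpos : (0 : ℝ) < (1 / ((n + 1 : ℕ) : ℝ)) ^ d := by positivity
    have hv0 : ∀ k : Fin d → Fin (n + 1), volume (cell k) ≠ 0 := by
      intro k; rw [volume_cell hN]; simpa using hpos
    have hvt : ∀ k : Fin d → Fin (n + 1), volume (cell k) ≠ ⊤ := by
      intro k; rw [volume_cell hN]; exact ENNReal.ofReal_ne_top
    have hi : ∀ k : Fin d → Fin (n + 1), IntegrableOn f (cell k) volume := fun k =>
      hint.mono_set ((hcell k).trans (halfOpenCube_subset_unitCube d))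
    have hle : ∀ k : Fin d → Fin (n + 1), ∃ x ∈ cell k,
        ∫ x in cell k, f x ≤ (1 / ((n + 1 : ℕ) : ℝ)) ^ d * f x := by
      intro k
      obtain ⟨x, hx, h⟩ := exists_setAverage_le (hv0 k) (hvt k) (hi k)
      rw [setAverage_eq, hvol, smul_eq_mul, inv_mul_le_iff₀ hpos] at h
      exact ⟨x, hx, h⟩
    have hge : ∀ k : Fin d → Fin (n + 1), ∃ x ∈ cell k,
        (1 / ((n + 1 : ℕ) : ℝ)) ^ d * f x ≤ ∫ x in cell k, f x := by
      intro k
      obtain ⟨x, hx, h⟩ := exists_le_setAverage (hv0 k) (hvt k) (hi k)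
      rw [setAverage_eq, hvol, smul_eq_mul, le_inv_mul_iff₀ hpos] at h
      exact ⟨x, hx, h⟩
    choose w hw hwle using hle
    choose w' hw' hwge using hge
    have h1 := (abs_le.1 (hmean w hw)).2
    have h2 := (abs_le.1 (hmean w' hw')).1
    have h3 := Finset.sum_le_sum fun k (_ : k ∈ Finset.univ) => hwle k
    have h4 := Finset.sum_le_sum fun k (_ : k ∈ Finset.univ) => hwge k
    rw [← setIntegral_unitCube_eq_sum_cell hN hint] at h3 h4
    rw [abs_le]
    constructor <;> linarith
  have hlim : Tendsto (fun n : ℕ => (D + 3 * d * (1 / ((n : ℝ) + 1))) * V) atTop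
      (nhds ((D + 3 * d * 0) * V)) :=
    ((tendsto_one_div_add_atTop_nhds_zero_nat.const_mul _).const_add D).mul_const _
  rw [mul_zero, add_zero] at hlim
  exact ge_of_tendsto' hlim key

/-! ### Nearest neighbours in a uniform sample -/

/-- The points within `r` of `s` in every coordinate. -/
def coordNeighborhood {d : ℕ} (s : EuclideanSpace ℝ (Fin d)) (r : ℝ) :
    Set (EuclideanSpace ℝ (Fin d)) :=
  {x | ∀ j, x j ∈ Set.Icc (s j - r) (s j + r)}

lemma measurableSet_coordNeighborhood {d : ℕ} (s : EuclideanSpace ℝ (Fin d)) (r : ℝ) :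
    MeasurableSet (coordNeighborhood s r) :=
  measurableSet_coordBox fun _ => measurableSet_Icc

lemma dist_le_of_mem_coordNeighborhood {d : ℕ} {s x : EuclideanSpace ℝ (Fin d)} {r : ℝ}
    (hr : 0 ≤ r) (hx : x ∈ coordNeighborhood s r) : dist s x ≤ √d * r := by
  rw [EuclideanSpace.dist_eq]
  have h : ∀ j, dist (s j) (x j) ^ 2 ≤ r ^ 2 := by
    intro j
    have h1 := (hx j).1
    have h2 := (hx j).2
    refine pow_le_pow_left₀ dist_nonneg ?_ 2
    rw [Real.dist_eq, abs_le]
    constructor <;> linarith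
  calc √(∑ j, dist (s j) (x j) ^ 2) ≤ √(∑ _j : Fin d, r ^ 2) :=
        Real.sqrt_le_sqrt (Finset.sum_le_sum fun j _ => h j)
    _ = √d * r := by
        rw [Finset.sum_const, Finset.card_univ, Fintype.card_fin, nsmul_eq_mul,
          Real.sqrt_mul (Nat.cast_nonneg d), Real.sqrt_sq hr]

lemma abs_coord_sub_le_dist {d : ℕ} (x z : EuclideanSpace ℝ (Fin d)) (j : Fin d) :
    |x j - z j| ≤ dist x z := by
  rw [dist_eq_norm]
  exact PiLp.norm_apply_le (x - z) j

/-- An interval of radius `r` around a point of `[0,1]` meets `[0,1]` in a set of length at least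
`min r 1`, even if the point is an end point. -/
lemma le_volume_unitCube_inter {d : ℕ} {s : EuclideanSpace ℝ (Fin d)} (hs : s ∈ unitCube d)
    {r : ℝ} (hr : 0 ≤ r) :
    ENNReal.ofReal (min r 1 ^ d) ≤ volume (unitCube d ∩ coordNeighborhood s r) := by
  have e : unitCube d ∩ coordNeighborhood s r = {x : EuclideanSpace ℝ (Fin d) |
      ∀ j, x j ∈ Set.Icc (0 : ℝ) 1 ∩ Set.Icc (s j - r) (s j + r)} := by
    ext x
    exact forall_and.symm
  rw [e, volume_coordBox fun _ => measurableSet_Icc.inter measurableSet_Icc]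
  have h : ∀ j, ENNReal.ofReal (min r 1) ≤
      volume (Set.Icc (0 : ℝ) 1 ∩ Set.Icc (s j - r) (s j + r)) := by
    intro j
    rw [Set.Icc_inter_Icc, Real.volume_Icc]
    refine ENNReal.ofReal_le_ofReal ?_
    have h0 := (hs j).1
    have h1 := (hs j).2
    rcases le_total r 1 with h | h
    · rw [min_eq_left h]
      rcases max_cases 0 (s j - r) with ⟨h2, _⟩ | ⟨h2, _⟩ <;>
        rcases min_cases 1 (s j + r) with ⟨h3, _⟩ | ⟨h3, _⟩ <;>
        simp only [max_def, min_def] at * <;> split_ifs at * <;> linarith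
    · rw [min_eq_right h]
      have h2 : max 0 (s j - r) = 0 := max_eq_left (by linarith)
      have h3 : min 1 (s j + r) = 1 := min_eq_left (by linarith)
      rw [h2, h3, sub_zero]
  calc ENNReal.ofReal (min r 1 ^ d) = ∏ _j : Fin d, ENNReal.ofReal (min r 1) := by
        rw [ENNReal.ofReal_pow (le_min hr zero_le_one)]; simp
    _ ≤ _ := Finset.prod_le_prod' fun j _ => h j

section Sample

variable {Ω : Type*} [MeasurableSpace Ω] {P : Measure Ω} {d : ℕ}

lemma measure_preimage_of_isUniform_unitCube {Y : Ω → EuclideanSpace ℝ (Fin d)}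
    (hY : pdf.IsUniform Y (unitCube d) P volume) {A : Set (EuclideanSpace ℝ (Fin d))}
    (hA : MeasurableSet A) : P (Y ⁻¹' A) = volume (unitCube d ∩ A) := by
  rw [hY.measure_preimage (by simp [volume_unitCube]) (by simp [volume_unitCube]) hA,
    volume_unitCube, div_one]

lemma ae_mem_halfOpenCube {X : ℕ → Ω → EuclideanSpace ℝ (Fin d)}
    (hX : ∀ i, pdf.IsUniform (X i) (unitCube d) P volume) :
    ∀ᵐ ω ∂P, ∀ i, X i ω ∈ halfOpenCube d := by
  refine ae_all_iff.2 fun i => ?_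
  change P (X i ⁻¹' (halfOpenCube d)ᶜ) = 0
  rw [measure_preimage_of_isUniform_unitCube (hX i) (measurableSet_halfOpenCube d).compl]
  exact ae_le_set.1 (halfOpenCube_ae_eq_unitCube d).symm.le

/-- It is exponentially unlikely that the first `n` points all avoid a neighbourhood of `s`. -/
lemma measure_forall_notMem_coordNeighborhood_le [IsProbabilityMeasure P]
    {X : ℕ → Ω → EuclideanSpace ℝ (Fin d)} (hind : iIndepFun X P)
    (hX : ∀ i, pdf.IsUniform (X i) (unitCube d) P volume) {s : EuclideanSpace ℝ (Fin d)}
    (hs : s ∈ unitCube d) {r : ℝ} (hr : 0 ≤ r) {n : ℕ} (hn : 0 < n) :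
    P {ω | ∀ i < n, X i ω ∉ coordNeighborhood s r} ≤ ENNReal.ofReal (Real.exp (-(n * r ^ d))) := by
  have hA := measurableSet_coordNeighborhood s r
  have e : {ω | ∀ i < n, X i ω ∉ coordNeighborhood s r} =
      ⋂ i ∈ Finset.range n, X i ⁻¹' (coordNeighborhood s r)ᶜ := by
    ext ω
    simp
  have hone : ∀ i, P (X i ⁻¹' (coordNeighborhood s r)ᶜ) ≤ ENNReal.ofReal (1 - min r 1 ^ d) := by
    intro i
    have h := measure_inter_add_sdiff (μ := volume) (unitCube d) hA
    rw [volume_unitCube] at h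
    rw [measure_preimage_of_isUniform_unitCube (hX i) hA.compl, ← Set.sdiff_eq,
      ENNReal.ofReal_sub _ (pow_nonneg (le_min hr zero_le_one) d), ENNReal.ofReal_one]
    refine ENNReal.le_sub_of_add_le_right ENNReal.ofReal_ne_top ?_
    rw [← h, add_comm]
    gcongr
    exact le_volume_unitCube_inter hs hr
  have h01 : (0 : ℝ) ≤ 1 - min r 1 ^ d :=
    sub_nonneg.2 (pow_le_one₀ (le_min hr zero_le_one) (min_le_right _ _))
  rw [e, hind.measure_inter_preimage_eq_mul (Finset.range n) fun _ _ => hA.compl]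
  calc ∏ i ∈ Finset.range n, P (X i ⁻¹' (coordNeighborhood s r)ᶜ)
      ≤ ∏ _i ∈ Finset.range n, ENNReal.ofReal (1 - min r 1 ^ d) :=
        Finset.prod_le_prod' fun i _ => hone i
    _ = ENNReal.ofReal ((1 - min r 1 ^ d) ^ n) := by
        rw [Finset.prod_const, Finset.card_range, ENNReal.ofReal_pow h01]
    _ ≤ _ := by
        refine ENNReal.ofReal_le_ofReal ?_
        rcases le_total r 1 with h | h
        · rw [min_eq_left h] at h01 ⊢
          have h2 : 1 - r ^ d ≤ Real.exp (-(r ^ d)) := by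
            have := Real.add_one_le_exp (-(r ^ d)); linarith
          refine (pow_le_pow_left₀ h01 h2 n).trans_eq ?_
          rw [← Real.exp_nat_mul]
          ring_nf
        · rw [min_eq_right h]
          simp only [one_pow, sub_self, zero_pow hn.ne']
          positivity

end Sample

lemma exists_forall_mul_exp_neg_mul_rpow_le {η ε : ℝ} (hη : 0 < η) (hε : 0 < ε) :
    ∃ L : ℝ, 0 < L ∧ ∀ q : ℝ, 1 ≤ q → q * Real.exp (-(L * q ^ η)) ≤ ε := by
  refine ⟨1 / η + 1 / ε, by positivity, fun q hq => ?_⟩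
  have hq0 : 0 < q := by linarith
  have h1 : Real.log q ≤ q ^ η / η := Real.log_le_rpow_div hq0.le hη
  have h2 : 1 ≤ q ^ η := Real.one_le_rpow hq hη.le
  have h3 : 1 / ε ≤ 1 / ε * q ^ η := le_mul_of_one_le_right (by positivity) h2
  have h4 : 1 / ε ≤ Real.exp (1 / ε) := by linarith [Real.add_one_le_exp (1 / ε)]
  calc q * Real.exp (-((1 / η + 1 / ε) * q ^ η))
      = Real.exp (Real.log q - (1 / η + 1 / ε) * q ^ η) := by
        rw [sub_eq_add_neg, Real.exp_add, Real.exp_log hq0]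
    _ ≤ Real.exp (-(1 / ε)) := by
        refine Real.exp_le_exp.2 ?_
        have : (1 / η + 1 / ε) * q ^ η = q ^ η / η + 1 / ε * q ^ η := by ring
        rw [this]
        linarith
    _ ≤ ε := by
        rw [Real.exp_neg]
        refine inv_le_of_inv_le₀ hε ?_
        rwa [← one_div]

/-! ### The subsample of nearest neighbours -/

lemma localDiscrepancy_eq {d q : ℕ} (t : Fin q → EuclideanSpace ℝ (Fin d))
    (a : EuclideanSpace ℝ (Fin d)) : localDiscrepancy t a = |boxFraction t a - ∏ j, a j| := by
  rw [localDiscrepancy, boxFraction, Fintype.card_fin]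

lemma localDiscrepancy_le_starDiscrepancy {d q : ℕ} (t : Fin q → EuclideanSpace ℝ (Fin d))
    {a : EuclideanSpace ℝ (Fin d)} (ha : a ∈ unitCube d) :
    localDiscrepancy t a ≤ starDiscrepancy t := by
  refine le_ciSup (f := fun a : unitCube d =>
    localDiscrepancy t (a : EuclideanSpace ℝ (Fin d))) ⟨1, ?_⟩ ⟨a, ha⟩
  rintro _ ⟨b, rfl⟩
  have h1 := boxFraction_mem_Icc t (b : EuclideanSpace ℝ (Fin d))
  have h2 := prod_mem_Icc b.2
  simp only [localDiscrepancy_eq]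
  rw [abs_le]
  constructor <;> linarith [h1.1, h1.2, h2.1, h2.2]

/-- If every design point has a sample point within `r` in every coordinate, then the nearest
neighbours inherit the discrepancy of the design, up to a factor `2` and an error of order `r`. -/
lemma abs_boxFraction_nearestNeighbor_sub_prod_le {d n q : ℕ} (hq : 0 < q)
    {x : Fin n → EuclideanSpace ℝ (Fin d)} (hx : ∀ i, x i ∈ unitCube d)
    {s t : Fin q → EuclideanSpace ℝ (Fin d)} (hs : ∀ j, s j ∈ unitCube d)
    (ht : ∀ j, IsNearestNeighbor x (s j) (t j)) {r : ℝ} (hr : 0 ≤ r)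
    (hclose : ∀ j, ∃ i, x i ∈ coordNeighborhood (s j) r)
    {a : EuclideanSpace ℝ (Fin d)} (ha : a ∈ unitCube d) :
    |boxFraction t a - ∏ j, a j| ≤ 2 * starDiscrepancy s + d * (√d * r) := by
  have : Nonempty (Fin q) := ⟨⟨0, hq⟩⟩
  refine abs_boxFraction_sub_prod_le_of_close hs (fun j => ?_) (fun j k => ?_)
    (fun a ha => ?_) ha
  · obtain ⟨i, hi⟩ := (ht j).1
    exact hi ▸ hx i
  · obtain ⟨i, hi⟩ := hclose j
    exact (abs_coord_sub_le_dist _ _ k).trans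
      (((ht j).2 i).trans (dist_le_of_mem_coordNeighborhood hr hi))
  · rw [← localDiscrepancy_eq]
    exact localDiscrepancy_le_starDiscrepancy s ha

theorem lemma2 {Ω : Type*} [MeasurableSpace Ω] (P : Measure Ω) [IsProbabilityMeasure P]
    (d : ℕ) (hd : 0 < d)
    -- the sample: independent and uniformly distributed on the unit cube
    (X : ℕ → Ω → EuclideanSpace ℝ (Fin d))
    (hX_indep : iIndepFun X P)
    (hX_unif : ∀ i, pdf.IsUniform (X i) (unitCube d) P volume)
    -- the size of the subsample
    (q : ℕ → ℕ) (hq_pos : ∀ n, 0 < q n)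
    (hq : (fun n => (q n : ℝ)) =O[atTop] fun n => (n : ℝ) ^ (1 / (d : ℝ)))
    -- the design points, of low star discrepancy
    (δ : ℝ) (hδ : 0 < δ)
    (s : ∀ n, Fin (q n) → EuclideanSpace ℝ (Fin d))
    (hs_mem : ∀ n j, s n j ∈ unitCube d)
    (hs_disc : (fun n => starDiscrepancy (s n)) =O[atTop] fun n => (q n : ℝ) ^ (-(1 - δ)))
    -- the selected subsample: a nearest neighbour of each design point among the first `n` points
    (Xstar : ∀ n, Fin (q n) → Ω → EuclideanSpace ℝ (Fin d))
    (hXstar : ∀ n, 0 < n → ∀ j ω,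
      IsNearestNeighbor (fun i : Fin n => X i ω) (s n j) (Xstar n j ω))
    -- the functions, whose products have uniformly bounded Hardy-Krause variation
    {ι : Type*} (φ : ι → EuclideanSpace ℝ (Fin d) → ℝ)
    (hφ_meas : ∀ ν, AEStronglyMeasurable (φ ν) (volume.restrict (unitCube d)))
    (C₂ : ℝ≥0) (hφ_var : ∀ ν μ, hardyKrauseVariation (fun x => φ ν x * φ μ x) ≤ C₂) :
    (∀ ν μ, IntegrableOn (fun x => φ ν x * φ μ x) (unitCube d) volume) ∧
    UniformBigOInProbability P
      (fun n (p : ι × ι) ω =>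
        (∫ x in unitCube d, φ p.1 x * φ p.2 x) -
          (1 / (q n : ℝ)) * ∑ j, φ p.1 (Xstar n j ω) * φ p.2 (Xstar n j ω))
      (fun n => (q n : ℝ) ^ (-(1 - δ))) := by
  have hmeas : ∀ ν μ, AEStronglyMeasurable (fun x => φ ν x * φ μ x)
      (volume.restrict (unitCube d)) := fun ν μ => (hφ_meas ν).mul (hφ_meas μ)
  refine ⟨fun ν μ => integrableOn_of_hardyKrauseVariation_le (hmeas ν μ) (hφ_var ν μ), ?_⟩
  intro ε hε
  have hd' : (0 : ℝ) < d := by exact_mod_cast hd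
  obtain ⟨C, hC, hqC⟩ := hq.exists_pos
  obtain ⟨B, hB, hsB⟩ := hs_disc.exists_pos
  obtain ⟨L, hL, hLε⟩ := exists_forall_mul_exp_neg_mul_rpow_le (mul_pos hd' hδ) hε
  -- the radius `K * q ^ (-(1 - δ))` is chosen so that `n * radius ^ d ≥ L * q ^ (d * δ)`
  let K : ℝ := C * L ^ (1 / (d : ℝ))
  have hK : 0 < K := by positivity
  refine ⟨(2 * B + d * (√d * K)) * C₂, ?_⟩
  filter_upwards [hqC.bound, hsB.bound, eventually_gt_atTop 0] with n hqn hsn hn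
  have hq1 : (1 : ℝ) ≤ q n := by exact_mod_cast hq_pos n
  have hq0 : (0 : ℝ) < q n := by linarith
  have hρ : 0 < (q n : ℝ) ^ (-(1 - δ)) := by positivity
  set ρ := (q n : ℝ) ^ (-(1 - δ)) with hρdef
  have hr : 0 ≤ K * ρ := by positivity
  have hnr : L * (q n : ℝ) ^ ((d : ℝ) * δ) ≤ n * (K * ρ) ^ d := by
    rw [Real.norm_of_nonneg hq0.le, Real.norm_of_nonneg (by positivity)] at hqn
    have h1 : (q n : ℝ) ^ d ≤ C ^ d * n := by
      refine (pow_le_pow_left₀ hq0.le hqn d).trans_eq ?_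
      rw [mul_pow, one_div, Real.rpow_inv_natCast_pow (Nat.cast_nonneg n) hd.ne']
    have h2 : (q n : ℝ) ^ ((d : ℝ) * δ) = (q n : ℝ) ^ d * ρ ^ d := by
      rw [← mul_pow, hρdef]
      nth_rewrite 2 [← Real.rpow_one (q n : ℝ)]
      rw [← Real.rpow_add hq0, ← Real.rpow_natCast, ← Real.rpow_mul hq0.le]
      congr 1
      ring
    have h3 : K ^ d = C ^ d * L := by
      rw [mul_pow, one_div, Real.rpow_inv_natCast_pow hL.le hd.ne']
    rw [h2, mul_pow, h3]
    calc L * ((q n : ℝ) ^ d * ρ ^ d) ≤ L * ((C ^ d * n) * ρ ^ d) := by gcongr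
      _ = n * (C ^ d * L * ρ ^ d) := by ring
  have hgood : {ω | ∃ p : ι × ι, (2 * B + d * (√d * K)) * C₂ * ρ <
        |(∫ x in unitCube d, φ p.1 x * φ p.2 x) -
          (1 / (q n : ℝ)) * ∑ j, φ p.1 (Xstar n j ω) * φ p.2 (Xstar n j ω)|} ⊆
      {ω | ¬ ∀ i, X i ω ∈ halfOpenCube d} ∪
        ⋃ j : Fin (q n), {ω | ∀ i < n, X i ω ∉ coordNeighborhood (s n j) (K * ρ)} := by
    rintro ω ⟨p, hp⟩
    by_contra hω
    simp only [Set.mem_union, Set.mem_ofPred_eq, not_or, not_not, Set.mem_iUnion, not_exists] at hω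
    obtain ⟨hcube, hnear⟩ := hω
    refine not_le.2 hp ?_
    have : Nonempty (Fin (q n)) := ⟨⟨0, hq_pos n⟩⟩
    have hKH := abs_setIntegral_sub_mean_le (t := fun j => Xstar n j ω) (fun j => by
        obtain ⟨i, hi⟩ := (hXstar n hn j ω).1
        simp only [hi]
        exact hcube i)
      (fun a ha => abs_boxFraction_nearestNeighbor_sub_prod_le (hq_pos n)
        (fun i : Fin n => halfOpenCube_subset_unitCube d (hcube i)) (hs_mem n)
        (fun j => hXstar n hn j ω) hr (fun j => by
          have := hnear j
          push Not at this
          obtain ⟨i, hin, hi⟩ := this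
          exact ⟨⟨i, hin⟩, hi⟩) ha)
      (hmeas p.1 p.2) (hφ_var p.1 p.2)
    rw [Fintype.card_fin] at hKH
    refine hKH.trans ?_
    have h1 : starDiscrepancy (s n) ≤ B * ρ := by
      rw [Real.norm_of_nonneg hρ.le] at hsn
      exact (le_abs_self _).trans hsn
    calc (2 * starDiscrepancy (s n) + d * (√d * (K * ρ))) * (C₂ : ℝ)
        ≤ (2 * (B * ρ) + d * (√d * (K * ρ))) * C₂ := by gcongr
      _ = _ := by ring
  have hnull : P {ω | ¬ ∀ i, X i ω ∈ halfOpenCube d} = 0 := ae_mem_halfOpenCube hX_unif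
  calc _ ≤ _ := measure_mono hgood
    _ ≤ P {ω | ¬ ∀ i, X i ω ∈ halfOpenCube d} +
        ∑ j : Fin (q n), P {ω | ∀ i < n, X i ω ∉ coordNeighborhood (s n j) (K * ρ)} :=
      (measure_union_le _ _).trans (by gcongr; exact measure_iUnion_fintype_le _ _)
    _ ≤ 0 + ∑ _j : Fin (q n), ENNReal.ofReal (Real.exp (-(n * (K * ρ) ^ d))) := by
      rw [hnull]
      gcongr with j
      exact measure_forall_notMem_coordNeighborhood_le hX_indep hX_unif (hs_mem n j) hr hn
    _ = ENNReal.ofReal (q n * Real.exp (-(n * (K * ρ) ^ d))) := by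
      rw [zero_add, ENNReal.ofReal_mul hq0.le]
      simp
    _ ≤ ENNReal.ofReal (q n * Real.exp (-(L * (q n : ℝ) ^ ((d : ℝ) * δ)))) := by
      gcongr
    _ ≤ ENNReal.ofReal ε := ENNReal.ofReal_le_ofReal (hLε _ hq1)
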